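/- **Theorem.** Let $F=\{F_1,\dots,F_m\}$ be a system of polynomials in $\mathbb{R}[x_1,\dots,x_n]$ and let $V_{\mathbb R}(F)\subseteq\mathbb{R}^n$ be its set of common real zeros. Let $\mathfrak S$ be the set of singular points of $V_{\mathbb R}(F)$, that is, the points near which $V_{\mathbb R}(F)$ is not a real analytic submanifold of $\mathbb{R}^n$ of any dimension (so isolated points are nonsingular, of dimension $0$). A random finite set $W\subseteq\mathbb{R}^n$ is called a *real witness set* of $V_{\mathbb R}(F)$ if for each connected component $C$ of $V_{\mathbb R}(F)\setminus\mathfrak S$ it contains, almost surely, a random point of $C$ whose law is absolutely continuous with respect to the volume on $C$ (the $k$-dimensional Hausdorff measure, where $k=\dim C$; the counting measure if $k=0$). If $C$ has finite volume, a uniformly distributed point of $C$ is such a point. Let $W$ be a real witness set of $V_{\mathbb R}(F)$ and let $f\in\mathbb{R}[x_1,\dots,x_n]$ be a fixed polynomial. Then, with probability one, if $f(p)=0$ for every $p\in W$, then $V_{\mathbb R}(F)\subseteq V_{\mathbb R}(f)$. Consequently this is a probabilistic test for membership of $f$ in the real radical $\sqrt[\mathbb R]{\langle F\rangle}$, understood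 as the ideal of all polynomials that vanish at every real zero of $\langle F\rangle$: with probability one, if $W\subseteq V_{\mathbb R}(F)$, then $f$ vanishes at every point of $W$ if and only if $f\in\sqrt[\mathbb R]{\langle F\rangle}$. -/

import Mathlib

open MeasureTheory

noncomputable section

/-- The common real zeros `V_ℝ(S) ⊆ ℝⁿ` of a set `S` of real polynomials in `n` variables. -/
def realZeroSet {n : ℕ} (S : Set (MvPolynomial (Fin n) ℝ)) : Set (EuclideanSpace ℝ (Fin n)) :=
  {x | ∀ q ∈ S, MvPolynomial.eval (fun i => x i) q = 0}

/-- `x` is a nonsingular point of dimension `k` of `V ⊆ ℝⁿ`: near `x`, the set `V` is a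
`k`-dimensional real analytic submanifold of `ℝⁿ`, that is, the zero set of `n - k` real analytic
functions whose differentials at `x` are linearly independent. -/
def IsNonsingularPoint {n : ℕ} (V : Set (EuclideanSpace ℝ (Fin n))) (k : ℕ)
    (x : EuclideanSpace ℝ (Fin n)) : Prop :=
  x ∈ V ∧ ∃ (c : ℕ) (U : Set (EuclideanSpace ℝ (Fin n)))
    (g : EuclideanSpace ℝ (Fin n) → EuclideanSpace ℝ (Fin c)),
    k + c = n ∧ IsOpen U ∧ x ∈ U ∧ AnalyticOnNhd ℝ g U ∧
    Function.Surjective (fderiv ℝ g x) ∧ V ∩ U = {y | g y = 0} ∩ U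

/-- The set of singular points of `V`: those at which `V` is not locally a real analytic
submanifold of any dimension. (Isolated points of `V` are nonsingular of dimension `0`.) -/
def singularPoints {n : ℕ} (V : Set (EuclideanSpace ℝ (Fin n))) :
    Set (EuclideanSpace ℝ (Fin n)) :=
  {x | x ∈ V ∧ ∀ k : ℕ, ¬ IsNonsingularPoint V k x}

/-- The volume on the nonsingular part of `V`: on the piece of dimension `k` it is the
`k`-dimensional Hausdorff measure (counting measure on isolated points). -/
def nonsingularVolume {n : ℕ} (V : Set (EuclideanSpace ℝ (Fin n))) :
    Measure (EuclideanSpace ℝ (Fin n)) :=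
  Measure.sum fun k : ℕ =>
    (Measure.hausdorffMeasure (k : ℝ)).restrict {x | IsNonsingularPoint V k x}

/-- `C` is a connected component of the nonsingular part `V \ singularPoints V`. -/
def IsNonsingularComponent {n : ℕ} (V C : Set (EuclideanSpace ℝ (Fin n))) : Prop :=
  ∃ x ∈ V \ singularPoints V, C = connectedComponentIn (V \ singularPoints V) x

/-- `p` is a random point on the component `C` of the nonsingular part of `V`: it lies on `C`, and
its law is absolutely continuous with respect to the volume on `C`. If `C` has finite volume, this
includes the uniform distribution on `C`; if the volume of `C` is infinite, there is no uniform
distribution, but there are random points in this sense. -/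
structure IsRandomPointOn {n : ℕ} {Ω : Type*} [MeasurableSpace Ω] (P : Measure Ω)
    (V C : Set (EuclideanSpace ℝ (Fin n))) (p : Ω → EuclideanSpace ℝ (Fin n)) : Prop where
  aemeasurable : AEMeasurable p P
  mem : ∀ᵐ ω ∂P, p ω ∈ C
  absolutelyContinuous : P.map p ≪ (nonsingularVolume V).restrict C

/-- A random finite set `W ⊆ ℝⁿ` is a real witness set of `V` if it contains a random point on
each connected component of the nonsingular part of `V`. -/
structure IsRealWitnessSet {n : ℕ} {Ω : Type*} [MeasurableSpace Ω] (P : Measure Ω)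
    (V : Set (EuclideanSpace ℝ (Fin n))) (W : Ω → Set (EuclideanSpace ℝ (Fin n))) : Prop where
  finite : ∀ ω, (W ω).Finite
  exists_point : ∀ C, IsNonsingularComponent V C →
    ∃ p : Ω → EuclideanSpace ℝ (Fin n), IsRandomPointOn P V C p ∧ ∀ᵐ ω ∂P, p ω ∈ W ω

/-- The real radical of an ideal `I` of `ℝ[x₁, …, xₙ]` in its geometric form: the ideal of all
polynomials that vanish at every real zero of `I`. -/
def realRadical {n : ℕ} (I : Ideal (MvPolynomial (Fin n) ℝ)) :
    Ideal (MvPolynomial (Fin n) ℝ) where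
  carrier := {q | ∀ x ∈ realZeroSet (I : Set (MvPolynomial (Fin n) ℝ)),
    MvPolynomial.eval (fun i => x i) q = 0}
  add_mem' := by
    intro a b ha hb x hx
    simp [ha x hx, hb x hx]
  zero_mem' := by
    intro x _
    simp
  smul_mem' := by
    intro c a ha x hx
    simp [ha x hx]

end

/-! If `f` is nonzero somewhere on `V`, the open set where `f ≠ 0` contains a nonsingular point of
`V`, because these are dense (`exists_isNonsingularPoint_mem`). On the component `C` of that point
the zero set of `f` is null (`IsNonsingularComponent.nonsingularVolume_restrict_zeroSet`): in
analytic charts this is the one-variable statement applied along rays, and the identity theorem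
propagates vanishing from one chart to all of `C`. A random point of `C` thus almost surely detects
`f`.

Density needs no dimension theory. In `S = V ∩ U` choose a point `y` where the largest number `r` of
polynomials `g b` vanishing on `S` have independent differentials. Then `{g = 0}` is a manifold near
`y` containing `S`. Conversely, by `eventually_eval_comp_eq_zero`, every polynomial vanishing on `S`
vanishes to infinite order along analytic curves in `{g = 0}` through `y`, so `V` and `{g = 0}`
agree near `y`. -/

open MeasureTheory Filter Topology

/-! ### Zero sets of analytic functions are null -/

/-- The zero set of a one-variable analytic function that is not identically zero is null. -/
theorem volume_zeroSet_eq_zero_of_isPreconnected {h : ℝ → ℝ} {I : Set ℝ} (hI : IsPreconnected I)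
    (hh : AnalyticOnNhd ℝ h I) {r₀ : ℝ} (hr₀ : r₀ ∈ I) (hne : h r₀ ≠ 0) :
    volume {r ∈ I | h r = 0} = 0 := by
  refine measure_null_of_locally_null _ fun z hz => ?_
  rcases (hh z hz.1).eventually_eq_zero_or_eventually_ne_zero with h0 | h0
  · exact absurd (hh.eqOn_zero_of_preconnected_of_eventuallyEq_zero hI hz.1 h0 hr₀) hne
  · refine ⟨{z}, ?_, by simp⟩
    rw [eventually_nhdsWithin_iff] at h0
    refine mem_nhdsWithin_iff_eventually.2 ?_
    filter_upwards [h0] with y hy hyz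
    by_contra hne
    exact hy hne hyz.2

/-- Polar coordinates: a measurable set that meets every ray from the origin in a null set is
null. -/
theorem measure_eq_zero_of_rays {E : Type*} [NormedAddCommGroup E] [NormedSpace ℝ E]
    [FiniteDimensional ℝ E] [MeasurableSpace E] [BorelSpace E] (μ : Measure E)
    [μ.IsAddHaarMeasure] {Z : Set E} (hZ : MeasurableSet Z) (h0 : (0 : E) ∉ Z)
    (hray : ∀ u : E, volume {r : ℝ | r • u ∈ Z} = 0) : μ Z = 0 := by
  have hZc : Z = ((↑) : ({0}ᶜ : Set E) → E) '' (((↑) : ({0}ᶜ : Set E) → E) ⁻¹' Z) := by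
    rw [Subtype.image_preimage_coe, Set.inter_eq_right.2]
    intro z hz hz0
    exact h0 (by simpa using (Set.mem_singleton_iff.1 hz0) ▸ hz)
  have hme : MeasurableEmbedding ((↑) : ({0}ᶜ : Set E) → E) :=
    MeasurableEmbedding.subtype_coe (measurableSet_singleton _).compl
  rw [hZc, ← hme.comap_apply]
  have hm : MeasurableSet (((↑) : ({0}ᶜ : Set E) → E) ⁻¹' Z) := measurable_subtype_coe hZ
  set e := homeomorphUnitSphereProd E
  have he := μ.measurePreserving_homeomorphUnitSphereProd.symm e.toMeasurableEquiv
  rw [← he.measure_preimage hm.nullMeasurableSet]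
  have hm' : MeasurableSet (e.toMeasurableEquiv.symm ⁻¹' (((↑) : ({0}ᶜ : Set E) → E) ⁻¹' Z)) :=
    e.toMeasurableEquiv.symm.measurable hm
  rw [Measure.measure_prod_null hm']
  refine Filter.Eventually.of_forall fun u => ?_
  -- The radial measure has a density with respect to Lebesgue measure on `(0, ∞)`.
  refine withDensity_absolutelyContinuous _ _ ?_
  rw [comap_subtype_coe_apply measurableSet_Ioi]
  refine measure_mono_null ?_ (hray u)
  rintro _ ⟨r, hr, rfl⟩
  simpa [e] using hr

/-- The zero set of an analytic function on a convex open set is null unless the function is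
identically zero. -/
theorem measure_zeroSet_eq_zero_of_convex {E : Type*} [NormedAddCommGroup E] [NormedSpace ℝ E]
    [FiniteDimensional ℝ E] [MeasurableSpace E] [BorelSpace E] (μ : Measure E)
    [μ.IsAddHaarMeasure] {g : E → ℝ} {U : Set E} (hUo : IsOpen U) (hU : Convex ℝ U)
    (hg : AnalyticOnNhd ℝ g U) {x₀ : E} (hx₀ : x₀ ∈ U) (hne : g x₀ ≠ 0) :
    μ {x ∈ U | g x = 0} = 0 := by
  have hZ : MeasurableSet {x ∈ U | g x = 0} := by
    have : {x ∈ U | g x = 0} = U \ (U ∩ g ⁻¹' {0}ᶜ) := by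
      ext x; simp only [Set.mem_ofPred_eq, Set.mem_sdiff, Set.mem_inter_iff, Set.mem_preimage,
        Set.mem_compl_iff, Set.mem_singleton_iff]; tauto
    rw [this]
    exact hUo.measurableSet.diff
      (hg.continuousOn.isOpen_inter_preimage hUo isOpen_compl_singleton).measurableSet
  -- With `x₀` moved to the origin, each line through it meets `U` in an interval containing `0`,
  -- where `g` is nonzero.
  rw [← measure_preimage_add_right μ x₀]
  refine measure_eq_zero_of_rays μ (measurable_add_const x₀ hZ) (by simp [hne]) fun u => ?_
  have hlin : ∀ r : ℝ, AnalyticAt ℝ (fun r : ℝ => r • u + x₀) r := fun r =>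
    (analyticAt_id.smul analyticAt_const).add analyticAt_const
  have hcv : Convex ℝ ((fun r : ℝ => r • u + x₀) ⁻¹' U) := by
    intro a ha b hb s t hs ht hst
    have := hU ha hb hs ht hst
    rw [Set.mem_preimage]
    convert this using 1
    have hx : x₀ = (s + t) • x₀ := by rw [hst, one_smul]
    simp only [smul_eq_mul]
    nth_rewrite 1 [hx]
    module
  exact volume_zeroSet_eq_zero_of_isPreconnected (I := (fun r : ℝ => r • u + x₀) ⁻¹' U)
    (h := fun r => g (r • u + x₀)) hcv.isPreconnected
    (fun r hr => AnalyticAt.comp (g := g) (f := fun r : ℝ => r • u + x₀) (hg _ hr) (hlin r)) (r₀ := 0) (by simpa using hx₀) (by simpa using hne)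

/-! ### Analytic charts of zero sets -/

/-- Implicit function theorem: near a point where the differential of the analytic function `g` is
surjective, the zero set of `g` has an analytic, Lipschitz parametrization by a ball. -/
theorem exists_analytic_parametrization {E F : Type*} [NormedAddCommGroup E] [NormedSpace ℝ E]
    [FiniteDimensional ℝ E] [NormedAddCommGroup F] [NormedSpace ℝ F] [FiniteDimensional ℝ F]
    {g : E → F} {x : E} {k : ℕ} (hg : AnalyticAt ℝ g x) (hx : g x = 0)
    (hs : Function.Surjective (fderiv ℝ g x))
    (hk : k + Module.finrank ℝ F = Module.finrank ℝ E) {U : Set E} (hU : U ∈ 𝓝 x) :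
    ∃ (φ : (Fin k → ℝ) → E) (ε : ℝ) (U₀ : Set E), 0 < ε ∧ IsOpen U₀ ∧ x ∈ U₀ ∧ U₀ ⊆ U ∧
      AnalyticOnNhd ℝ φ (Metric.ball 0 ε) ∧ (∃ K, LipschitzOnWith K φ (Metric.ball 0 ε)) ∧
      φ '' Metric.ball 0 ε = {y | g y = 0} ∩ U₀ ∧ φ 0 = x := by
  have : CompleteSpace E := FiniteDimensional.complete ℝ E
  have : CompleteSpace F := FiniteDimensional.complete ℝ F
  have hker := (fderiv ℝ g x).ker_closedComplemented_of_finiteDimensional_range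
  -- `e` is `y ↦ (g y, π (y - x))`, with `π` a projection onto the kernel; its inverse on `{0} ×
  -- ker` is the chart.
  let Φ := HasStrictFDerivAt.implicitFunctionDataOfComplemented g (fderiv ℝ g x)
    hg.hasStrictFDerivAt (LinearMap.range_eq_top.2 hs) hker
  let e := Φ.toOpenPartialHomeomorph
  have hxs : x ∈ e.source := Φ.pt_mem_toOpenPartialHomeomorph_source
  have hefst : ∀ y, (e y).1 = g y := fun y => rfl
  have hex : e x = (0, 0) := by
    refine Prod.ext (by simp [hefst, hx]) ?_
    change Classical.choose hker (x - x) = 0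
    simp
  have hean : AnalyticAt ℝ e x := by
    refine hg.prod ?_
    exact ((Classical.choose hker).analyticAt _).comp (analyticAt_id.sub analyticAt_const)
  obtain ⟨i, hi⟩ : (fderiv ℝ e x).IsInvertible := Φ.isInvertible_fderiv_prodFun
  have hsan : AnalyticAt ℝ e.symm (0, 0) := hex ▸ e.analyticAt_symm' hxs hean hi.symm
  have hsx : e.symm (0, 0) = x := by rw [← hex, e.left_inv hxs]
  have hfr : Module.finrank ℝ (Fin k → ℝ) = Module.finrank ℝ (fderiv ℝ g x).ker := by
    have h1 := (fderiv ℝ g x).toLinearMap.finrank_range_add_finrank_ker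
    rw [LinearMap.range_eq_top.2 hs, finrank_top] at h1
    simp only [Module.finrank_fin_fun]
    change _ = Module.finrank ℝ (fderiv ℝ g x).toLinearMap.ker
    omega
  let L : (Fin k → ℝ) ≃L[ℝ] (fderiv ℝ g x).ker := ContinuousLinearEquiv.ofFinrankEq hfr
  let φ : (Fin k → ℝ) → E := fun t => e.symm (0, L t)
  have hφan : AnalyticAt ℝ φ 0 := by
    refine AnalyticAt.comp (g := e.symm) (f := fun t => ((0 : F), L t)) (by simpa using hsan) ?_
    exact analyticAt_const.prod (L.toContinuousLinearMap.analyticAt 0)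
  obtain ⟨K, s, hs, hK⟩ := (hφan.contDiffAt (n := 1)).exists_lipschitzOnWith
  have hT : e.target ∩ e.symm ⁻¹' U ∈ 𝓝 ((0 : F), (0 : (fderiv ℝ g x).ker)) := by
    refine inter_mem (e.open_target.mem_nhds (hex ▸ e.map_source hxs)) ?_
    exact hsan.continuousAt (by rwa [hsx])
  rw [nhds_prod_eq, mem_prod_iff] at hT
  obtain ⟨A, hA, B, hB, hAB⟩ := hT
  have hLB : L ⁻¹' B ∈ 𝓝 0 := L.continuous.continuousAt (by simpa using hB)
  obtain ⟨ε, hε, hball⟩ := Metric.mem_nhds_iff.1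
    (inter_mem (inter_mem hs hLB) hφan.eventually_analyticAt)
  have hLopen : IsOpen (L '' Metric.ball 0 ε) := L.toHomeomorph.isOpenMap _ Metric.isOpen_ball
  refine ⟨φ, ε, e.source ∩ e ⁻¹' (interior A ×ˢ (L '' Metric.ball 0 ε)), hε,
    e.isOpen_inter_preimage (isOpen_interior.prod hLopen), ⟨hxs, ?_⟩, ?_, fun t ht => (hball ht).2,
    ⟨K, hK.mono fun t ht => (hball ht).1.1⟩, ?_, ?_⟩
  · rw [Set.mem_preimage, hex]
    exact ⟨mem_interior_iff_mem_nhds.2 hA, 0, by simpa using hε, by simp⟩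
  · rintro y ⟨hy, hy1, t, ht, hty⟩
    have : e.symm (e y) ∈ U := (hAB ⟨interior_subset hy1, hty ▸ (hball ht).1.2⟩).2
    rwa [e.left_inv hy] at this
  · ext y
    constructor
    · rintro ⟨t, ht, rfl⟩
      have htB : L t ∈ B := (hball ht).1.2
      have htar : ((0 : F), L t) ∈ e.target := (hAB ⟨mem_of_mem_nhds hA, htB⟩).1
      have hes : e (φ t) = (0, L t) := e.right_inv htar
      refine ⟨?_, e.map_target htar, ?_⟩
      · rw [Set.mem_ofPred_eq, ← hefst, hes]
      · rw [Set.mem_preimage, hes]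
        exact ⟨mem_interior_iff_mem_nhds.2 hA, t, ht, rfl⟩
    · rintro ⟨hy, hys, -, t, ht, hty⟩
      refine ⟨t, ht, ?_⟩
      have : ((0 : F), L t) = e y := Prod.ext (by rw [hefst]; exact hy.symm) hty
      change e.symm (0, L t) = y
      rw [this, e.left_inv hys]
  · change e.symm (0, L 0) = x
    simpa using hsx

/-! ### Derivatives of polynomials -/

open MvPolynomial in
theorem hasFDerivAt_eval {n : ℕ} (p : MvPolynomial (Fin n) ℝ) (x : EuclideanSpace ℝ (Fin n)) :
    HasFDerivAt (fun y : EuclideanSpace ℝ (Fin n) => eval (fun i => y i) p)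
      (∑ i, eval (fun i => x i) (pderiv i p) •
        (EuclideanSpace.proj i : EuclideanSpace ℝ (Fin n) →L[ℝ] ℝ)) x := by
  induction p using MvPolynomial.induction_on with
  | C a => simpa using hasFDerivAt_const a x
  | add p q hp hq =>
    simp only [map_add, add_smul, Finset.sum_add_distrib]
    exact hp.add hq
  | mul_X p j hp =>
    have hj : HasFDerivAt (fun y : EuclideanSpace ℝ (Fin n) => y j)
        (EuclideanSpace.proj j : EuclideanSpace ℝ (Fin n) →L[ℝ] ℝ) x :=
      (EuclideanSpace.proj j : EuclideanSpace ℝ (Fin n) →L[ℝ] ℝ).hasFDerivAt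
    simp only [map_mul, eval_X]
    refine (hp.mul hj).congr_fderiv ?_
    simp only [Derivation.leibniz, pderiv_X, smul_eq_mul, map_add, map_mul, eval_X, add_smul,
      Finset.sum_add_distrib, Finset.smul_sum, smul_smul]
    congr 1
    rw [Finset.sum_eq_single j]
    · simp
    · intro i _ hij
      simp [Pi.single_eq_of_ne hij.symm]
    · simp

theorem analyticAt_eval {n : ℕ} (p : MvPolynomial (Fin n) ℝ) (x : EuclideanSpace ℝ (Fin n)) :
    AnalyticAt ℝ (fun y : EuclideanSpace ℝ (Fin n) => MvPolynomial.eval (fun i => y i) p) x :=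
  AnalyticOnNhd.eval_continuousLinearMap'
    (fun i => (EuclideanSpace.proj i : EuclideanSpace ℝ (Fin n) →L[ℝ] ℝ)) p x trivial

theorem hasDerivAt_eval_comp {n : ℕ} (p : MvPolynomial (Fin n) ℝ)
    {γ : ℝ → EuclideanSpace ℝ (Fin n)} {t : ℝ} (hγ : DifferentiableAt ℝ γ t) :
    HasDerivAt (fun s => MvPolynomial.eval (fun i => γ s i) p)
      (∑ j, MvPolynomial.eval (fun i => γ t i) (MvPolynomial.pderiv j p) * deriv γ t j) t := by
  refine ((hasFDerivAt_eval p (γ t)).comp_hasDerivAt t hγ.hasDerivAt).congr_deriv ?_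
  simp

/-! ### Jacobian minors and density of nonsingular points -/

/-- The matrix of the directional derivatives of the polynomials `f b` in the directions `u a`. -/
noncomputable def directionalJacobian {n r : ℕ} (u : Fin r → Fin n → ℝ)
    (f : Fin r → MvPolynomial (Fin n) ℝ) : Matrix (Fin r) (Fin r) (MvPolynomial (Fin n) ℝ) :=
  Matrix.of fun a b => ∑ j, MvPolynomial.C (u a j) * MvPolynomial.pderiv j (f b)

/-- At some point of `S`, there are `r` polynomials vanishing on `S` whose differentials are
linearly independent. -/
def HasDifferentialRank {n : ℕ} (S : Set (EuclideanSpace ℝ (Fin n))) (r : ℕ) : Prop :=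
  ∃ y ∈ S, ∃ (u : Fin r → Fin n → ℝ) (g : Fin r → MvPolynomial (Fin n) ℝ),
    (∀ b, ∀ x ∈ S, MvPolynomial.eval (fun i => x i) (g b) = 0) ∧
    MvPolynomial.eval (fun i => y i) (directionalJacobian u g).det ≠ 0

open MvPolynomial in
/-- Expansion of the Jacobian determinant along its first direction: if `w` is tangent to the
`g b` at `x`, only the derivative of `h` along `w` survives. -/
theorem sum_mul_eval_det_directionalJacobian_cons {n r : ℕ} (u : Fin r → Fin n → ℝ)
    (g : Fin r → MvPolynomial (Fin n) ℝ) (h : MvPolynomial (Fin n) ℝ) (x w : Fin n → ℝ)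
    (hw : ∀ b, ∑ j, eval x (pderiv j (g b)) * w j = 0) :
    ∑ j, w j * eval x (directionalJacobian (Fin.cons (Pi.single j 1) u : Fin (r + 1) → Fin n → ℝ)
      (Fin.cons h g : Fin (r + 1) → MvPolynomial (Fin n) ℝ)).det =
    eval x (directionalJacobian u g).det * ∑ j, eval x (pderiv j h) * w j := by
  have hdet : ∀ j, (directionalJacobian (Fin.cons (Pi.single j 1) u : Fin (r + 1) → Fin n → ℝ)
      (Fin.cons h g : Fin (r + 1) → MvPolynomial (Fin n) ℝ)).det =
      ∑ b : Fin (r + 1), (-1) ^ (b : ℕ) *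
        pderiv j ((Fin.cons h g : Fin (r + 1) → MvPolynomial (Fin n) ℝ) b) *
        (directionalJacobian u
          (fun c => (Fin.cons h g : Fin (r + 1) → MvPolynomial (Fin n) ℝ) (b.succAbove c))).det := by
    intro j
    rw [Matrix.det_succ_row_zero]
    refine Finset.sum_congr rfl fun b _ => ?_
    congr 2
    simp only [directionalJacobian, Matrix.of_apply, Fin.cons_zero]
    rw [Finset.sum_eq_single j]
    · simp
    · intro i _ hij
      simp [Pi.single_eq_of_ne hij]
    · simp
  simp only [hdet, map_sum, map_mul, Finset.mul_sum]
  rw [Finset.sum_comm, Fin.sum_univ_succ]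
  -- The cofactors do not depend on `j`, so summing against `w j` turns this entry into the
  -- derivative of `g b` along `w`, which is zero.
  have hz : ∀ b : Fin r, ∑ j, w j * (eval x ((-1) ^ ((b.succ : Fin (r + 1)) : ℕ)) *
      eval x (pderiv j ((Fin.cons h g : Fin (r + 1) → MvPolynomial (Fin n) ℝ) b.succ)) *
      eval x (directionalJacobian u (fun c =>
        (Fin.cons h g : Fin (r + 1) → MvPolynomial (Fin n) ℝ) (b.succ.succAbove c))).det) = 0 := by
    intro b
    generalize (directionalJacobian u (fun c =>
        (Fin.cons h g : Fin (r + 1) → MvPolynomial (Fin n) ℝ) (b.succ.succAbove c))).det = D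
    have := congrArg (fun z => eval x ((-1) ^ ((b.succ : Fin (r + 1)) : ℕ)) * eval x D * z) (hw b)
    simp only [mul_zero, Finset.mul_sum] at this
    rw [← this]
    refine Finset.sum_congr rfl fun j _ => ?_
    rw [Fin.cons_succ]
    ring
  rw [Finset.sum_eq_zero fun b _ => hz b, add_zero]
  refine Finset.sum_congr rfl fun j _ => ?_
  simp only [Fin.val_zero, pow_zero, map_one, one_mul, Fin.cons_zero, Fin.zero_succAbove,
    Fin.cons_succ]
  ring

theorem natCast_le_analyticOrderAt_sum {ι : Type*} (s : Finset ι) {F : ι → ℝ → ℝ} {z : ℝ} {m : ℕ}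
    (hF : ∀ i ∈ s, (m : ℕ∞) ≤ analyticOrderAt (F i) z) :
    (m : ℕ∞) ≤ analyticOrderAt (fun t => ∑ i ∈ s, F i t) z := by
  classical
  induction s using Finset.induction_on with
  | empty =>
    have : analyticOrderAt (fun _ : ℝ => (0 : ℝ)) z = ⊤ := analyticOrderAt_eq_top.2 (by simp)
    simp [this]
  | insert a s ha ih =>
    simp only [Finset.sum_insert ha]
    exact (le_min (hF a (by simp)) (ih fun i hi => hF i (by simp [hi]))).trans le_analyticOrderAt_add

/-- A polynomial vanishing on `S` vanishes along every analytic curve that starts at a point of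
maximal differential rank and on which the defining polynomials `g b` vanish. -/
theorem eventually_eval_comp_eq_zero {n r : ℕ} {S : Set (EuclideanSpace ℝ (Fin n))}
    (hmax : ¬ HasDifferentialRank S (r + 1)) {u : Fin r → Fin n → ℝ}
    {g : Fin r → MvPolynomial (Fin n) ℝ}
    (hg : ∀ b, ∀ x ∈ S, MvPolynomial.eval (fun i => x i) (g b) = 0)
    {γ : ℝ → EuclideanSpace ℝ (Fin n)} (hγ : AnalyticAt ℝ γ 0) (hγS : γ 0 ∈ S)
    (hdet : MvPolynomial.eval (fun i => γ 0 i) (directionalJacobian u g).det ≠ 0)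
    (hγg : ∀ b, ∀ᶠ t in 𝓝 0, MvPolynomial.eval (fun i => γ t i) (g b) = 0)
    {h : MvPolynomial (Fin n) ℝ} (hh : ∀ x ∈ S, MvPolynomial.eval (fun i => x i) h = 0) :
    ∀ᶠ t in 𝓝 0, MvPolynomial.eval (fun i => γ t i) h = 0 := by
  have han : ∀ p : MvPolynomial (Fin n) ℝ,
      AnalyticAt ℝ (fun t => MvPolynomial.eval (fun i => γ t i) p) 0 := fun p =>
    AnalyticAt.comp (g := fun y : EuclideanSpace ℝ (Fin n) => MvPolynomial.eval (fun i => y i) p)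
      (f := γ) (analyticAt_eval p (γ 0)) hγ
  -- The order bound is proved for all `h` at once, since the induction step passes from `h` to the
  -- minors `K j`.
  suffices H : ∀ m : ℕ, ∀ h : MvPolynomial (Fin n) ℝ,
      (∀ x ∈ S, MvPolynomial.eval (fun i => x i) h = 0) →
      (m : ℕ∞) ≤ analyticOrderAt (fun t => MvPolynomial.eval (fun i => γ t i) h) 0 by
    rw [← analyticOrderAt_eq_top]
    exact ENat.eq_top_iff_forall_ge.2 fun m => H m h hh
  clear hh h
  intro m
  induction m with
  | zero => simp
  | succ m ih =>
    intro h hh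
    have hd := (han h).analyticOrderAt_deriv_add_one
    simp only [hh _ hγS, sub_zero] at hd
    rw [← hd]
    push_cast
    gcongr
    have hprod : analyticOrderAt ((fun t => MvPolynomial.eval (fun i => γ t i)
        (directionalJacobian u g).det) *
        deriv fun t => MvPolynomial.eval (fun i => γ t i) h) 0 =
        analyticOrderAt (deriv fun t => MvPolynomial.eval (fun i => γ t i) h) 0 := by
      rw [analyticOrderAt_mul (han _) (han h).deriv, (han _).analyticOrderAt_eq_zero.2 hdet,
        zero_add]
    let K : Fin n → MvPolynomial (Fin n) ℝ := fun j =>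
      (directionalJacobian (Fin.cons (Pi.single j 1) u : Fin (r + 1) → Fin n → ℝ)
        (Fin.cons h g : Fin (r + 1) → MvPolynomial (Fin n) ℝ)).det
    -- A nonzero value of an `(r + 1)`-minor on `S` would contradict the maximality of `r`.
    have hK : ∀ j, ∀ x ∈ S, MvPolynomial.eval (fun i => x i) (K j) = 0 := by
      intro j x hx
      by_contra hne
      refine hmax ⟨x, hx, _, _, fun b => ?_, hne⟩
      refine Fin.cases ?_ (fun b => ?_) b
      · simpa using hh
      · simpa using hg b
    have hcongr : ((fun t => MvPolynomial.eval (fun i => γ t i) (directionalJacobian u g).det) *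
        deriv fun t => MvPolynomial.eval (fun i => γ t i) h) =ᶠ[𝓝 0]
        fun t => ∑ j, deriv γ t j * MvPolynomial.eval (fun i => γ t i) (K j) := by
      filter_upwards [hγ.eventually_analyticAt, eventually_all.2 fun b => (hγg b).eventually_nhds]
        with t ht htg
      rw [Pi.mul_apply, (hasDerivAt_eval_comp h ht.differentiableAt).deriv]
      refine (sum_mul_eval_det_directionalJacobian_cons u g h (fun i => γ t i)
        (fun j => deriv γ t j)         fun b => ?_).symm
      rw [← (hasDerivAt_eval_comp (g b) ht.differentiableAt).deriv,
        Filter.EventuallyEq.deriv_eq (f := fun _ => (0 : ℝ)) (htg b), deriv_const]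
    rw [← hprod, analyticOrderAt_congr hcongr]
    refine natCast_le_analyticOrderAt_sum _ fun j _ => ?_
    have hj : AnalyticAt ℝ (fun t => deriv γ t j) 0 :=
      ((EuclideanSpace.proj j : EuclideanSpace ℝ (Fin n) →L[ℝ] ℝ).analyticAt _).comp hγ.deriv
    change (m : ℕ∞) ≤ analyticOrderAt ((fun t => deriv γ t j) *
      fun t => MvPolynomial.eval (fun i => γ t i) (K j)) 0
    rw [analyticOrderAt_mul hj (han _)]
    exact (ih (K j) (hK j)).trans le_add_self

open MvPolynomial in
/-- If a Jacobian determinant of `g` does not vanish at `y`, the differential of `g` at `y` is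
surjective. -/
theorem surjective_fderiv_of_eval_det_ne_zero {n r : ℕ} {u : Fin r → Fin n → ℝ}
    {g : Fin r → MvPolynomial (Fin n) ℝ} {y : EuclideanSpace ℝ (Fin n)}
    (hdet : eval (fun i => y i) (directionalJacobian u g).det ≠ 0) :
    Function.Surjective (fderiv ℝ (fun x : EuclideanSpace ℝ (Fin n) =>
      WithLp.toLp 2 fun b => eval (fun i => x i) (g b)) y) := by
  have hder : HasFDerivAt (fun x : EuclideanSpace ℝ (Fin n) =>
      WithLp.toLp 2 fun b => eval (fun i => x i) (g b))
      ((EuclideanSpace.equiv (Fin r) ℝ).symm.toContinuousLinearMap.comp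
        (ContinuousLinearMap.pi fun b => ∑ i, eval (fun i => y i) (pderiv i (g b)) •
          (EuclideanSpace.proj i : EuclideanSpace ℝ (Fin n) →L[ℝ] ℝ))) y :=
    (EuclideanSpace.equiv (Fin r) ℝ).symm.hasFDerivAt.comp y
      (hasFDerivAt_pi.2 fun b => hasFDerivAt_eval (g b) y)
  rw [hder.fderiv]
  rw [RingHom.map_det] at hdet
  set A := (eval fun i => y i).mapMatrix (directionalJacobian u g) with hA
  intro z
  -- The differential already maps the span of the directions `u a` onto the target: on `∑ a, c a •
  -- u a` it is `Aᵀ c`.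
  obtain ⟨c, hc⟩ := (Matrix.mulVec_surjective_iff_isUnit (A := A.transpose)).2
    ((Matrix.isUnit_iff_isUnit_det _).2 (by rw [Matrix.det_transpose]; exact hdet.isUnit)) z
  refine ⟨WithLp.toLp 2 fun j => ∑ a, c a * u a j, ?_⟩
  ext b
  have hb := congrFun hc b
  rw [← hb]
  simp only [Matrix.mulVec, dotProduct, Matrix.transpose_apply, hA, RingHom.mapMatrix_apply,
    Matrix.map_apply, directionalJacobian, Matrix.of_apply, map_sum, map_mul, eval_C]
  simp only [ContinuousLinearMap.coe_comp, ContinuousLinearEquiv.coe_coe, Function.comp_apply]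
  change (∑ i, eval (fun i => y i) (pderiv i (g b)) •
          (EuclideanSpace.proj i : EuclideanSpace ℝ (Fin n) →L[ℝ] ℝ))
          (WithLp.toLp 2 fun j => ∑ a, c a * u a j) = _
  trans ∑ j, eval (fun i => y i) (pderiv j (g b)) * ∑ a, c a * u a j
  · simp
  · simp only [Finset.mul_sum, Finset.sum_mul]
    rw [Finset.sum_comm]
    refine Finset.sum_congr rfl fun a _ => Finset.sum_congr rfl fun j _ => ?_
    ring

/-- The nonsingular points of a real algebraic set are dense in it. -/
theorem exists_isNonsingularPoint_mem {n m : ℕ} (F : Fin m → MvPolynomial (Fin n) ℝ)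
    {U : Set (EuclideanSpace ℝ (Fin n))} (hU : IsOpen U)
    (hne : (realZeroSet (Set.range F) ∩ U).Nonempty) :
    ∃ y ∈ realZeroSet (Set.range F) ∩ U, ∃ k, IsNonsingularPoint (realZeroSet (Set.range F)) k y := by
  set V := realZeroSet (Set.range F) with hV
  set S := V ∩ U with hS
  have hle : ∀ r, HasDifferentialRank S r → r ≤ n := by
    rintro r ⟨y, -, u, g, -, hdet⟩
    have := LinearMap.finrank_le_finrank_of_surjective
      (f := (fderiv ℝ (fun x : EuclideanSpace ℝ (Fin n) =>
        WithLp.toLp 2 fun b => MvPolynomial.eval (fun i => x i) (g b)) y).toLinearMap)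
      (surjective_fderiv_of_eval_det_ne_zero hdet)
    simpa using this
  -- Rank `0` is attained, the empty determinant being `1`, and ranks are at most `n`.
  obtain ⟨r, hr, hr1⟩ : ∃ r, HasDifferentialRank S r ∧ ¬ HasDifferentialRank S (r + 1) := by
    by_contra! hcon
    have hall : ∀ r, HasDifferentialRank S r := by
      intro r
      induction r with
      | zero =>
        obtain ⟨y, hy⟩ := hne
        exact ⟨y, hy, Fin.elim0, Fin.elim0, fun b => b.elim0, by simp⟩
      | succ r ih => exact hcon r ih
    have := hle _ (hall (n + 1))
    omega
  have hrn := hle r hr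
  obtain ⟨y, hy, u, g, hg, hdet⟩ := hr
  let G : EuclideanSpace ℝ (Fin n) → EuclideanSpace ℝ (Fin r) := fun x =>
    WithLp.toLp 2 fun b => MvPolynomial.eval (fun i => x i) (g b)
  have hG0 : ∀ x, G x = 0 ↔ ∀ b, MvPolynomial.eval (fun i => x i) (g b) = 0 := by
    intro x
    constructor
    · intro h b
      exact congrArg (fun z : EuclideanSpace ℝ (Fin r) => z b) h
    · intro h
      ext b
      exact h b
  have hGan : ∀ x, AnalyticAt ℝ G x := fun x =>
    ((EuclideanSpace.equiv (Fin r) ℝ).symm.toContinuousLinearMap.analyticAt _).comp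
      (AnalyticAt.pi fun b => analyticAt_eval (g b) x)
  have hsurj := surjective_fderiv_of_eval_det_ne_zero hdet
  obtain ⟨φ, ε, U₀, hε, hU₀, hyU₀, hU₀U, hφ, -, himg, hφ0⟩ :=
    exists_analytic_parametrization (k := n - r) (hGan y) ((hG0 y).2 fun b => hg b y hy) hsurj
      (by simp; omega) (hU.mem_nhds hy.2)
  refine ⟨y, hy, n - r, hy.1, r, U₀, G, by omega, hU₀, hyU₀, fun x _ => hGan x, hsurj, ?_⟩
  ext z
  constructor
  · rintro ⟨hzV, hzU⟩
    exact ⟨(hG0 z).2 fun b => hg b z ⟨hzV, hU₀U hzU⟩, hzU⟩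
  · rintro ⟨hz, hzU⟩
    refine ⟨?_, hzU⟩
    -- The segment from `0` to `v` gives a curve in `{G = 0}` from `y` to `z`; `F i` vanishes on it
    -- near `t = 0`, hence up to `t = 1`.
    obtain ⟨v, hv, rfl⟩ : z ∈ φ '' Metric.ball 0 ε := himg ▸ ⟨hz, hzU⟩
    have hvanish : ∀ t : ℝ, t • v ∈ Metric.ball (0 : Fin (n - r) → ℝ) ε → G (φ (t • v)) = 0 :=
      fun t ht => (himg ▸ Set.mem_image_of_mem φ ht : φ (t • v) ∈ {y | G y = 0} ∩ U₀).1
    rintro _ ⟨i, rfl⟩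
    have hlin : ∀ t : ℝ, AnalyticAt ℝ (fun t : ℝ => t • v) t := fun t =>
      analyticAt_id.smul analyticAt_const
    set J : Set ℝ := (fun t : ℝ => t • v) ⁻¹' Metric.ball 0 ε with hJ
    have hJo : IsOpen J := Metric.isOpen_ball.preimage (by fun_prop)
    have hJc : Convex ℝ J := (convex_ball (0 : Fin (n - r) → ℝ) ε).linear_preimage
      (LinearMap.toSpanSingleton ℝ _ v)
    have h0J : (0 : ℝ) ∈ J := by simp [hJ, hε]
    have h1J : (1 : ℝ) ∈ J := by simpa [hJ] using hv
    have hγ : ∀ t ∈ J, AnalyticAt ℝ (fun t : ℝ => φ (t • v)) t := fun t ht =>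
      AnalyticAt.comp (g := φ) (f := fun t : ℝ => t • v) (hφ _ ht) (hlin t)
    have hev := eventually_eval_comp_eq_zero (γ := fun t : ℝ => φ (t • v)) (h := F i) hr1 hg
      (hγ 0 h0J) (by simpa [hφ0] using hy) (by simpa [hφ0] using hdet)
      (fun b => by
        filter_upwards [hJo.mem_nhds h0J] with t ht
        exact (hG0 _).1 (hvanish t ht) b)
      (fun x hx => hx.1 (F i) ⟨i, rfl⟩)
    have hanJ : AnalyticOnNhd ℝ
        (fun t : ℝ => MvPolynomial.eval (fun j => φ (t • v) j) (F i)) J := fun t ht =>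
      AnalyticAt.comp
        (g := fun x : EuclideanSpace ℝ (Fin n) => MvPolynomial.eval (fun j => x j) (F i))
        (f := fun t : ℝ => φ (t • v)) (analyticAt_eval _ _) (hγ t ht)
    simpa using hanJ.eqOn_zero_of_preconnected_of_eventuallyEq_zero hJc.isPreconnected h0J hev h1J

/-! ### Identity theorem on components -/

/-- Near a nonsingular point, `V` has an analytic, Lipschitz parametrization by a ball. -/
theorem IsNonsingularPoint.exists_parametrization {n k : ℕ} {V : Set (EuclideanSpace ℝ (Fin n))}
    {x : EuclideanSpace ℝ (Fin n)} (h : IsNonsingularPoint V k x) :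
    ∃ (φ : (Fin k → ℝ) → EuclideanSpace ℝ (Fin n)) (ε : ℝ)
      (U₀ : Set (EuclideanSpace ℝ (Fin n))), IsOpen U₀ ∧ x ∈ U₀ ∧
      AnalyticOnNhd ℝ φ (Metric.ball 0 ε) ∧ (∃ K, LipschitzOnWith K φ (Metric.ball 0 ε)) ∧
      φ '' Metric.ball 0 ε = V ∩ U₀ := by
  obtain ⟨hxV, c, U, g, hkc, hU, hxU, hg, hsurj, hVU⟩ := h
  have hgx : g x = 0 := (hVU ▸ ⟨hxV, hxU⟩ : x ∈ {y | g y = 0} ∩ U).1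
  obtain ⟨φ, ε, U₀, -, hU₀, hxU₀, hU₀U, hφ, hK, himg, -⟩ :=
    exists_analytic_parametrization (hg x hxU) hgx hsurj (by simpa using hkc) (hU.mem_nhds hxU)
  refine ⟨φ, ε, U₀, hU₀, hxU₀, hφ, hK, himg.trans ?_⟩
  rw [← Set.inter_eq_right.2 hU₀U, ← Set.inter_assoc, ← Set.inter_assoc, hVU]

/-- Identity theorem: a polynomial vanishing on `V` near one point of a component of the
nonsingular part of `V` vanishes on the whole component. -/
theorem IsNonsingularComponent.eval_eq_zero {n : ℕ} {V C : Set (EuclideanSpace ℝ (Fin n))}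
    (hC : IsNonsingularComponent V C) (f : MvPolynomial (Fin n) ℝ)
    {x : EuclideanSpace ℝ (Fin n)} (hx : x ∈ C)
    (hf : ∀ᶠ y in 𝓝[V] x, MvPolynomial.eval (fun i => y i) f = 0) :
    ∀ y ∈ C, MvPolynomial.eval (fun i => y i) f = 0 := by
  obtain ⟨x₀, hx₀, rfl⟩ := hC
  have hsub : connectedComponentIn (V \ singularPoints V) x₀ ⊆ V \ singularPoints V :=
    connectedComponentIn_subset _ _
  set O₁ : Set (EuclideanSpace ℝ (Fin n)) :=
    {z | ∃ U, IsOpen U ∧ z ∈ U ∧ ∀ y ∈ V ∩ U, MvPolynomial.eval (fun i => y i) f = 0} with hO₁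
  set O₂ : Set (EuclideanSpace ℝ (Fin n)) := {z | ∃ U, IsOpen U ∧ z ∈ U ∧ ∀ y ∈ V ∩ U, y ∉ O₁}
    with hO₂
  have ho₁ : IsOpen O₁ := isOpen_iff_forall_mem_open.2 fun z ⟨U, hU, hz, h⟩ =>
    ⟨U, fun w hw => ⟨U, hU, hw, h⟩, hU, hz⟩
  have ho₂ : IsOpen O₂ := isOpen_iff_forall_mem_open.2 fun z ⟨U, hU, hz, h⟩ =>
    ⟨U, fun w hw => ⟨U, hU, hw, h⟩, hU, hz⟩
  -- In a chart around `z` that meets `O₁`, `f` vanishes near one parameter and hence on the whole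
  -- ball; otherwise `z ∈ O₂`.
  have hcov : ∀ z ∈ V \ singularPoints V, z ∈ O₁ ∪ O₂ := by
    rintro z ⟨hzV, hzs⟩
    obtain ⟨k, hk⟩ : ∃ k, IsNonsingularPoint V k z := by
      by_contra! hcon
      exact hzs ⟨hzV, hcon⟩
    obtain ⟨φ, ε, U₀, hU₀, hzU₀, hφ, -, himg⟩ := hk.exists_parametrization
    rw [Set.mem_union, or_iff_not_imp_right]
    intro hz2
    have : ∃ y ∈ V ∩ U₀, y ∈ O₁ := by
      by_contra! hcon
      exact hz2 ⟨U₀, hU₀, hzU₀, hcon⟩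
    obtain ⟨y, hy, U, hU, hyU, hUf⟩ := this
    refine ⟨U₀, hU₀, hzU₀, ?_⟩
    rw [← himg] at hy ⊢
    obtain ⟨t, ht, rfl⟩ := hy
    have han : AnalyticOnNhd ℝ (fun t => MvPolynomial.eval (fun j => φ t j) f)
        (Metric.ball 0 ε) := fun t ht =>
      AnalyticAt.comp
        (g := fun x : EuclideanSpace ℝ (Fin n) => MvPolynomial.eval (fun j => x j) f)
        (f := φ) (analyticAt_eval _ _) (hφ t ht)
    have hev : (fun t => MvPolynomial.eval (fun j => φ t j) f) =ᶠ[𝓝 t] 0 := by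
      filter_upwards [Metric.isOpen_ball.mem_nhds ht,
        (hφ t ht).continuousAt (hU.mem_nhds hyU)] with s hs hsU
      have : φ s ∈ V ∩ U₀ := himg ▸ Set.mem_image_of_mem φ hs
      exact hUf _ ⟨this.1, hsU⟩
    rintro _ ⟨s, hs, rfl⟩
    exact han.eqOn_zero_of_preconnected_of_eventuallyEq_zero
      (convex_ball (0 : Fin k → ℝ) ε).isPreconnected ht hev hs
  have hx1 : x ∈ O₁ := by
    obtain ⟨U, hU, hxU, h⟩ := mem_nhdsWithin.1 hf
    exact ⟨U, hU, hxU, fun y hy => h ⟨hy.2, hy.1⟩⟩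
  intro y hy
  have hy1 : y ∈ O₁ := by
    by_contra hy1
    obtain ⟨w, hwC, hw1, U, hU, hwU, hw⟩ := isPreconnected_connectedComponentIn O₁ O₂ ho₁ ho₂
      (fun z hz => hcov z (hsub hz)) ⟨x, hx, hx1⟩ ⟨y, hy, (hcov y (hsub hy)).resolve_left hy1⟩
    exact hw w ⟨(hsub hwC).1, hwU⟩ hw1
  obtain ⟨U, hU, hyU, h⟩ := hy1
  exact h y ⟨(hsub hy).1, hyU⟩

/-! ### Null zero sets on components -/

/-- Surjectivity of continuous linear maps onto a finite-dimensional space is an open condition. -/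
theorem eventually_surjective_of_continuousAt {X E F : Type*} [TopologicalSpace X]
    [NormedAddCommGroup E] [NormedSpace ℝ E] [FiniteDimensional ℝ E]
    [NormedAddCommGroup F] [NormedSpace ℝ F] [FiniteDimensional ℝ F]
    {A : X → E →L[ℝ] F} {x : X} (hA : ContinuousAt A x) (hs : Function.Surjective (A x)) :
    ∀ᶠ y in 𝓝 x, Function.Surjective (A y) := by
  have : CompleteSpace F := FiniteDimensional.complete ℝ F
  -- Composing with a right inverse of `A x` gives operators near the identity, and units form an
  -- open set.
  obtain ⟨R, hR⟩ := (A x).toLinearMap.exists_rightInverse_of_surjective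
    (LinearMap.range_eq_top.2 hs)
  let R' : F →L[ℝ] E := LinearMap.toContinuousLinearMap R
  have hAR : (A x).comp R' = 1 := by
    ext z
    exact LinearMap.congr_fun hR z
  have hc : ContinuousAt (fun y => (A y).comp R') x := hA.clm_comp continuousAt_const
  have hu : ∀ᶠ y in 𝓝 x, IsUnit ((A y).comp R') :=
    hc (Units.isOpen.mem_nhds ((congrArg IsUnit hAR).mpr isUnit_one))
  filter_upwards [hu] with y hy z
  obtain ⟨B, hB⟩ := hy.exists_right_inv
  exact ⟨R' (B z), DFunLike.congr_fun hB z⟩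

/-- The nonsingular points of dimension `k` form an open subset of `V`. -/
theorem exists_isOpen_setOf_isNonsingularPoint {n : ℕ} (V : Set (EuclideanSpace ℝ (Fin n)))
    (k : ℕ) : ∃ O, IsOpen O ∧ {x | IsNonsingularPoint V k x} = V ∩ O := by
  refine ⟨{x | ∀ᶠ y in 𝓝 x, y ∈ V → IsNonsingularPoint V k y},
    isOpen_iff_mem_nhds.2 fun x hx => hx.eventually_nhds, ?_⟩
  ext x
  refine ⟨fun hx => ⟨hx.1, ?_⟩, fun hx => hx.2.self_of_nhds hx.1⟩
  obtain ⟨-, c, U, g, hkc, hU, hxU, hg, hsurj, hVU⟩ := hx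
  filter_upwards [hU.mem_nhds hxU,
    eventually_surjective_of_continuousAt (hg x hxU).fderiv.continuousAt hsurj] with y hy hys hyV
  exact ⟨hyV, c, U, g, hkc, hU, hy, hg, hys, hVU⟩

/-- A polynomial that does not vanish identically on a component of the nonsingular part of `V`
vanishes only on a null set of it. -/
theorem IsNonsingularComponent.nonsingularVolume_restrict_zeroSet {n : ℕ}
    {V C : Set (EuclideanSpace ℝ (Fin n))} (hV : MeasurableSet V)
    (hC : IsNonsingularComponent V C)
    (f : MvPolynomial (Fin n) ℝ) {x : EuclideanSpace ℝ (Fin n)} (hx : x ∈ C)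
    (hf : MvPolynomial.eval (fun i => x i) f ≠ 0) :
    (nonsingularVolume V).restrict C {y | MvPolynomial.eval (fun i => y i) f = 0} = 0 := by
  have hcont : Continuous fun y : EuclideanSpace ℝ (Fin n) =>
      MvPolynomial.eval (fun i => y i) f :=
    continuous_iff_continuousAt.2 fun y => (analyticAt_eval f y).continuousAt
  have hmeas : MeasurableSet {y : EuclideanSpace ℝ (Fin n) |
      MvPolynomial.eval (fun i => y i) f = 0} := (isClosed_eq hcont continuous_const).measurableSet
  rw [Measure.restrict_apply hmeas, nonsingularVolume, Measure.sum_apply_eq_zero]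
  intro k
  have hNS : MeasurableSet {x | IsNonsingularPoint V k x} := by
    obtain ⟨O, hO, heq⟩ := exists_isOpen_setOf_isNonsingularPoint V k
    rw [heq]
    exact hV.inter hO.measurableSet
  rw [Measure.restrict_apply' hNS]
  refine measure_null_of_locally_null _ fun z hz => ?_
  obtain ⟨⟨-, hzC⟩, hzk⟩ := hz
  obtain ⟨φ, ε, U₀, hU₀, hzU₀, hφ, ⟨K, hK⟩, himg⟩ := IsNonsingularPoint.exists_parametrization hzk
  refine ⟨{y | MvPolynomial.eval (fun i => y i) f = 0} ∩ (V ∩ U₀), ?_, ?_⟩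
  · refine mem_nhdsWithin.2 ⟨U₀, hU₀, hzU₀, ?_⟩
    rintro y ⟨hyU, ⟨hyf, -⟩, hyk⟩
    exact ⟨hyf, hyk.1, hyU⟩
  · have hne : ∃ t ∈ Metric.ball (0 : Fin k → ℝ) ε, MvPolynomial.eval (fun i => φ t i) f ≠ 0 := by
      by_contra! hcon
      refine hf (hC.eval_eq_zero f hzC ?_ x hx)
      refine mem_nhdsWithin.2 ⟨U₀, hU₀, hzU₀, fun y hy => ?_⟩
      obtain ⟨t, ht, rfl⟩ : y ∈ φ '' Metric.ball 0 ε := himg ▸ ⟨hy.2, hy.1⟩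
      exact hcon t ht
    obtain ⟨t₀, ht₀, hne⟩ := hne
    have hnull : volume {t ∈ Metric.ball (0 : Fin k → ℝ) ε |
        MvPolynomial.eval (fun i => φ t i) f = 0} = 0 :=
      measure_zeroSet_eq_zero_of_convex volume Metric.isOpen_ball (convex_ball _ _)
        (fun t ht => AnalyticAt.comp
          (g := fun x : EuclideanSpace ℝ (Fin n) => MvPolynomial.eval (fun j => x j) f)
          (f := φ) (analyticAt_eval _ _) (hφ t ht)) ht₀ hne
    have hle := (hK.mono (Set.sep_subset (Metric.ball (0 : Fin k → ℝ) ε)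
      fun t => MvPolynomial.eval (fun i => φ t i) f = 0)).hausdorffMeasure_image_le
      (Nat.cast_nonneg (α := ℝ) k)
    -- For the sup metric on `Fin k → ℝ` the two measures agree exactly; the Lipschitz chart then
    -- carries null sets to null sets.
    have hH : (Measure.hausdorffMeasure (k : ℝ) : Measure (Fin k → ℝ)) = volume := by
      simpa using hausdorffMeasure_pi_real (ι := Fin k)
    rw [hH, hnull, mul_zero] at hle
    refine measure_mono_null ?_ (nonpos_iff_eq_zero.1 hle)
    rintro y ⟨hyf, hy⟩
    rw [← himg] at hy
    obtain ⟨t, ht, rfl⟩ := hy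
    exact ⟨t, ⟨ht, hyf⟩, rfl⟩

/-! ### The probabilistic test -/

theorem isClosed_realZeroSet {n : ℕ} (S : Set (MvPolynomial (Fin n) ℝ)) :
    IsClosed (realZeroSet S) := by
  have : realZeroSet S = ⋂ q ∈ S, {x | MvPolynomial.eval (fun i => x i) q = 0} := by
    ext x
    simp [realZeroSet]
  rw [this]
  refine isClosed_biInter fun q _ => isClosed_eq ?_ continuous_const
  exact continuous_iff_continuousAt.2 fun y => (analyticAt_eval q y).continuousAt

theorem realZeroSet_span {n : ℕ} (S : Set (MvPolynomial (Fin n) ℝ)) :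
    realZeroSet (Ideal.span S : Set (MvPolynomial (Fin n) ℝ)) = realZeroSet S := by
  ext x
  refine ⟨fun h q hq => h q (Ideal.subset_span hq), fun h q hq => ?_⟩
  have : Ideal.span S ≤ RingHom.ker (MvPolynomial.eval fun i => x i) :=
    Ideal.span_le.2 fun q hq => h q hq
  exact this hq

/-- If `f` does not vanish on the real zero set of `F`, then almost surely it does not vanish on a
real witness set. -/
theorem IsRealWitnessSet.ae_exists_eval_ne_zero {n m : ℕ} {Ω : Type*} [MeasurableSpace Ω]
    {P : Measure Ω} {F : Fin m → MvPolynomial (Fin n) ℝ} {W : Ω → Set (EuclideanSpace ℝ (Fin n))}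
    (hW : IsRealWitnessSet P (realZeroSet (Set.range F)) W) {f : MvPolynomial (Fin n) ℝ}
    (hf : ¬ realZeroSet (Set.range F) ⊆ realZeroSet {f}) :
    ∀ᵐ ω ∂P, ∃ p ∈ W ω, MvPolynomial.eval (fun i => p i) f ≠ 0 := by
  obtain ⟨x, hxV, hxf⟩ := Set.not_subset.1 hf
  have hopen : IsOpen {y : EuclideanSpace ℝ (Fin n) | MvPolynomial.eval (fun i => y i) f ≠ 0} :=
    isOpen_ne_fun (continuous_iff_continuousAt.2 fun y => (analyticAt_eval f y).continuousAt)
      continuous_const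
  obtain ⟨y, ⟨hyV, hyf⟩, k, hk⟩ := exists_isNonsingularPoint_mem F hopen
    ⟨x, hxV, fun h => hxf (by rintro q rfl; exact h)⟩
  have hys : y ∈ realZeroSet (Set.range F) \ singularPoints (realZeroSet (Set.range F)) :=
    ⟨hyV, fun h => h.2 k hk⟩
  have hC : IsNonsingularComponent (realZeroSet (Set.range F)) (connectedComponentIn
      (realZeroSet (Set.range F) \ singularPoints (realZeroSet (Set.range F))) y) := ⟨y, hys, rfl⟩
  obtain ⟨p, hp, hpW⟩ := hW.exists_point _ hC
  have hnull := hp.absolutelyContinuous (hC.nonsingularVolume_restrict_zeroSet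
    (isClosed_realZeroSet _).measurableSet f (mem_connectedComponentIn hys) hyf)
  have hae : ∀ᵐ z ∂P.map p, MvPolynomial.eval (fun i => z i) f ≠ 0 := by
    rw [ae_iff]
    simpa using hnull
  filter_upwards [hpW, ae_of_ae_map hp.aemeasurable hae] with ω hω hne
  exact ⟨p ω, hω, hne⟩

theorem mainTheorem2 {n m : ℕ} {Ω : Type*} [MeasurableSpace Ω] (P : MeasureTheory.Measure Ω)
    [MeasureTheory.IsProbabilityMeasure P]
    (F : Fin m → MvPolynomial (Fin n) ℝ)
    (W : Ω → Set (EuclideanSpace ℝ (Fin n)))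
    (hW : IsRealWitnessSet P (realZeroSet (Set.range F)) W)
    (f : MvPolynomial (Fin n) ℝ) :
    (∀ᵐ ω ∂P, (∀ p ∈ W ω, MvPolynomial.eval (fun i => p i) f = 0) →
      realZeroSet (Set.range F) ⊆ realZeroSet {f}) ∧
    (∀ᵐ ω ∂P, W ω ⊆ realZeroSet (Set.range F) →
      ((∀ p ∈ W ω, MvPolynomial.eval (fun i => p i) f = 0) ↔
        f ∈ realRadical (Ideal.span (Set.range F)))) := by
  have h1 : ∀ᵐ ω ∂P, (∀ p ∈ W ω, MvPolynomial.eval (fun i => p i) f = 0) →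
      realZeroSet (Set.range F) ⊆ realZeroSet {f} := by
    -- The inclusion is not random: either it holds, or almost surely some point of `W` refutes the
    -- premise.
    by_cases hf : realZeroSet (Set.range F) ⊆ realZeroSet {f}
    · exact Eventually.of_forall fun _ _ => hf
    · filter_upwards [hW.ae_exists_eval_ne_zero hf] with ω ⟨p, hp, hne⟩ hall
      exact absurd (hall p hp) hne
  have hrad : f ∈ realRadical (Ideal.span (Set.range F)) ↔
      ∀ x ∈ realZeroSet (Set.range F), MvPolynomial.eval (fun i => x i) f = 0 := by
    rw [← realZeroSet_span]
    exact Iff.rfl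
  refine ⟨h1, ?_⟩
  filter_upwards [h1] with ω hω hWV
  rw [hrad]
  exact ⟨fun h x hx => hω h hx f rfl, fun h p hp => h p (hWV hp)⟩
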